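/- Let $0\le p<n$ and $m\ge 0$ be integers, let $\mathbf Z\in\mathbb R^{n\times p}$ with $\mathbf Z^\intercal\mathbf Z$ invertible, $\mathbf H=\mathbf Z(\mathbf Z^\intercal\mathbf Z)^{-1}\mathbf Z^\intercal$, let $\mathbf X\in\mathbb R^{n\times m}$, and let $\boldsymbol\Sigma$ be a diagonal $n\times n$ matrix with non-negative diagonal entries. Put $F=\{1,\dots,m\}$. For $S\subseteq F$ let $\mathbf X_S$ be the submatrix of the columns of $\mathbf X$ indexed by $S$, let $\boldsymbol\lambda_S=(\lambda_1^S,\dots,\lambda_n^S)$ be the eigenvalues, with multiplicity and in descending order, of $$\boldsymbol\Sigma^{1/2}(\mathbf I-\mathbf H)\mathbf X_S\mathbf X_S^\intercal(\mathbf I-\mathbf H)\boldsymbol\Sigma^{1/2},$$ and let $\ell_S=\sum_{i=1}^n\lambda_i^S$. For $\alpha\in(0,1)$ and a vector $\boldsymbol\lambda\in\mathbb R^n$ let $c(\boldsymbol\lambda)$ be the $1-\alpha$ quantile $\inf\{t: P(\sum_{i=1}^n\lambda_i\xi_i\le t)\ge 1-\alpha\}$, where $\xi_1,\dots,\xi_n$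 are independent $\chi^2_1$ variables, and write $c_S=c(\boldsymbol\lambda_S)$. Fix $R\subseteq F$. Then for every $S$ with $R\subseteq S\subseteq F$ there is exactly one vector of the form $$\hat{\boldsymbol\lambda}(\ell_S)=(\lambda_1^F,\dots,\lambda_i^F,\eta,\lambda_{i+2}^R,\dots,\lambda_n^R),\qquad 0\le i\le n-1,\quad \lambda_{i+1}^R\le\eta\le\lambda_{i+1}^F,$$ that is in descending order and has sum $\ell_S$. With $c_{\max}(\ell_S)=c(\hat{\boldsymbol\lambda}(\ell_S))$, there is an $\alpha_0\in(0,1)$ such that for all $\alpha$ with $0<\alpha\le\alpha_0$ and all $S$ with $R\subseteq S\subseteq F$, $$c_S\le c_{\max}(\ell_S).$$ -/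

import Mathlib

/-- The eigenvalues of a real symmetric `n × n` matrix, with multiplicity, in descending order. -/
noncomputable def sortedEigenvalues {n : ℕ} {A : Matrix (Fin n) (Fin n) ℝ}
    (hA : A.IsHermitian) : Fin n → ℝ :=
  fun i => hA.eigenvalues₀ (Fin.cast (Fintype.card_fin n).symm i)

theorem sortedEigenvalues_antitone {n : ℕ} {A : Matrix (Fin n) (Fin n) ℝ}
    (hA : A.IsHermitian) : Antitone (sortedEigenvalues hA) :=
  fun _ _ h => hA.eigenvalues₀_antitone h

/-- The hat matrix `H = Z (Zᵀ Z)⁻¹ Zᵀ` of the confounders. -/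
noncomputable def hatMatrix {n p : ℕ} (Z : Matrix (Fin n) (Fin p) ℝ) :
    Matrix (Fin n) (Fin n) ℝ :=
  Z * (Z.transpose * Z)⁻¹ * Z.transpose

/-- The design matrix `X_S` consisting of the columns of `X` with index in `S`. -/
def subDesign {n m : ℕ} (X : Matrix (Fin n) (Fin m) ℝ) (S : Finset (Fin m)) :
    Matrix (Fin n) S ℝ :=
  X.submatrix id (fun j => (j : Fin m))

/-- `Σ^{1/2} (I - H) X_S X_Sᵀ (I - H) Σ^{1/2}`, where `Σ` is the diagonal covariance matrix with
diagonal `σ`. -/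
noncomputable def nullMatrix {n p m : ℕ} (Z : Matrix (Fin n) (Fin p) ℝ)
    (X : Matrix (Fin n) (Fin m) ℝ) (σ : Fin n → ℝ) (S : Finset (Fin m)) :
    Matrix (Fin n) (Fin n) ℝ :=
  Matrix.diagonal (fun i => Real.sqrt (σ i)) * (1 - hatMatrix Z) *
    (subDesign X S * (subDesign X S).transpose) *
    (1 - hatMatrix Z) * Matrix.diagonal (fun i => Real.sqrt (σ i))

theorem hatMatrix_transpose {n p : ℕ} (Z : Matrix (Fin n) (Fin p) ℝ) :
    (hatMatrix Z).transpose = hatMatrix Z := by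
  simp [hatMatrix, Matrix.transpose_mul, Matrix.transpose_nonsing_inv, Matrix.mul_assoc]

theorem nullMatrix_isHermitian {n p m : ℕ} (Z : Matrix (Fin n) (Fin p) ℝ)
    (X : Matrix (Fin n) (Fin m) ℝ) (σ : Fin n → ℝ) (S : Finset (Fin m)) :
    (nullMatrix Z X σ S).IsHermitian := by
  unfold Matrix.IsHermitian
  rw [Matrix.conjTranspose_eq_transpose_of_trivial]
  simp [nullMatrix, Matrix.transpose_mul, hatMatrix_transpose, Matrix.mul_assoc]

/-- The vector `λ_S` of weights of the null distribution for the feature set `S`: the eigenvalues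
of the matrix above in descending order. -/
noncomputable def nullWeights {n p m : ℕ} (Z : Matrix (Fin n) (Fin p) ℝ)
    (X : Matrix (Fin n) (Fin m) ℝ) (σ : Fin n → ℝ) (S : Finset (Fin m)) : Fin n → ℝ :=
  sortedEigenvalues (nullMatrix_isHermitian Z X σ S)

/-- The level `ℓ_S = ∑ i, λ_i^S` of the feature set `S`. -/
noncomputable def level {n p m : ℕ} (Z : Matrix (Fin n) (Fin p) ℝ)
    (X : Matrix (Fin n) (Fin m) ℝ) (σ : Fin n → ℝ) (S : Finset (Fin m)) : ℝ :=
  ∑ i, nullWeights Z X σ S i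

/-- The law of `∑ i, w i * χ²₁` with independent `χ²₁` variables, which are the squares of
independent standard normal variables. -/
noncomputable def weightedChiSq {n : ℕ} (w : Fin n → ℝ) : MeasureTheory.Measure ℝ :=
  (MeasureTheory.Measure.pi (fun _ : Fin n => ProbabilityTheory.gaussianReal 0 1)).map
    (fun z => ∑ i, w i * z i ^ 2)

/-- The critical value `c(w)` at significance level `α`: the `1 - α` quantile of the law of
`∑ i, w i * χ²₁`. -/
noncomputable def critValue (α : ℝ) {n : ℕ} (w : Fin n → ℝ) : ℝ :=
  sInf {t : ℝ | 1 - α ≤ (weightedChiSq w).real (Set.Iic t)}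

/-- `v` is the majorizing vector at level `ℓ` between the lower bound `lo` and the upper bound
`up`, both in descending order: a head of `up`, one connecting entry `η` between the bounds, and a
tail of `lo`, in descending order and with sum `ℓ`. -/
def IsMajorizingVector {n : ℕ} (up lo : Fin n → ℝ) (ℓ : ℝ) (v : Fin n → ℝ) : Prop :=
  ∃ (i : Fin n) (η : ℝ),
    (∀ j, j < i → v j = up j) ∧ v i = η ∧ (∀ j, i < j → v j = lo j) ∧
    lo i ≤ η ∧ η ≤ up i ∧ Antitone v ∧ ∑ j, v j = ℓ

/-! Enlarging `S` adds a positive semidefinite matrix, so the weights satisfy λ^R ≤ λ^S ≤ λ^F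
entrywise (`nullWeights_mono`). A vector v with a head of λ^F and a tail of λ^R therefore lies above
λ^S before its connecting index and below it afterwards. Since the sums agree, this single crossing
makes v majorize w = λ^S.

As α tends to 0 only the far tails of the weighted sums matter, and a largest weight μ gives
exponential rate 1/(2μ). If v has the larger leading entry, its tail decays more slowly
(`eventually_tail_le_of_lt`). If the leading entries agree, split off the coordinates where w equals
μ; v equals μ there too. Their sum has a tail g with g(t - b)/g(t) → exp(b/(2μ)), so the remaining
weights act only through the moment E exp(B/(2μ)) of their weighted sum B
(`IsExpTail.eventually_lintegral_le`). For w this is the product of the (1 - w_j/μ)^(-1/2). Strict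
convexity of -log(1 - x/μ) makes the moment of v strictly larger, and it is infinite if v has
further entries μ (`eventually_tail_le_of_eq`).

Tail domination beyond some threshold orders the quantiles for all small α, and there are only
finitely many `S`. -/

/-! ### Monotonicity of eigenvalues and of the null weights -/

theorem LinearMap.IsSymmetric.inner_apply_self_eq_sum {E : Type*} [NormedAddCommGroup E]
    [InnerProductSpace ℝ E] [FiniteDimensional ℝ E] {n : ℕ} {T : E →ₗ[ℝ] E}
    (hT : T.IsSymmetric) (hn : Module.finrank ℝ E = n) (x : E) :
    inner ℝ (T x) x
      = ∑ j, hT.eigenvalues hn j * (hT.eigenvectorBasis hn).repr x j ^ 2 := by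
  rw [← (hT.eigenvectorBasis hn).repr.inner_map_map, PiLp.inner_apply]
  refine Finset.sum_congr rfl fun j _ => ?_
  rw [hT.eigenvectorBasis_apply_self_apply hn x j]
  simp
  ring

/-- Courant–Fischer by a dimension count: some nonzero x is orthogonal to the eigenvectors of `U`
before `i` and to those of `T` after `i`, as these are only n - 1 conditions. The two quadratic
forms at x are then squeezed between the `i`-th eigenvalues times ‖x‖². -/
theorem LinearMap.IsSymmetric.eigenvalues_le_eigenvalues {E : Type*} [NormedAddCommGroup E]
    [InnerProductSpace ℝ E] [FiniteDimensional ℝ E] {n : ℕ} {T U : E →ₗ[ℝ] E}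
    (hT : T.IsSymmetric) (hU : U.IsSymmetric) (hn : Module.finrank ℝ E = n)
    (h : ∀ x, inner ℝ (T x) x ≤ inner ℝ (U x) x) (i : Fin n) :
    hT.eigenvalues hn i ≤ hU.eigenvalues hn i := by
  let a := hT.eigenvectorBasis hn
  let b := hU.eigenvectorBasis hn
  let f : E →ₗ[ℝ] ({j : Fin n // j ≠ i} → ℝ) := LinearMap.pi fun j =>
    if j.1 < i then
      (LinearMap.proj j.1) ∘ₗ (WithLp.linearEquiv 2 ℝ (Fin n → ℝ)).toLinearMap ∘ₗ
        b.repr.toLinearEquiv.toLinearMap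
    else
      (LinearMap.proj j.1) ∘ₗ (WithLp.linearEquiv 2 ℝ (Fin n → ℝ)).toLinearMap ∘ₗ
        a.repr.toLinearEquiv.toLinearMap
  have hlt : Module.finrank ℝ ({j : Fin n // j ≠ i} → ℝ) < Module.finrank ℝ E := by
    rw [hn, Module.finrank_fintype_fun_eq_card]
    have := Fintype.card_subtype_lt (p := fun j : Fin n => j ≠ i) (x := i) (by simp)
    simpa using this
  obtain ⟨x, hx, hx0⟩ := (Submodule.ne_bot_iff _).1 (f.ker_ne_bot_of_finrank_lt hlt)
  have hb : ∀ j, j < i → b.repr x j = 0 := fun j hj => by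
    have := congrFun (LinearMap.mem_ker.1 hx) ⟨j, hj.ne⟩
    simpa [f, hj] using this
  have ha : ∀ j, i < j → a.repr x j = 0 := fun j hj => by
    have := congrFun (LinearMap.mem_ker.1 hx) ⟨j, hj.ne'⟩
    simpa [f, hj.not_gt] using this
  have hna : ∑ j, a.repr x j ^ 2 = ‖x‖ ^ 2 := by
    rw [← a.repr.norm_map x, EuclideanSpace.norm_sq_eq]; simp
  have hnb : ∑ j, b.repr x j ^ 2 = ‖x‖ ^ 2 := by
    rw [← b.repr.norm_map x, EuclideanSpace.norm_sq_eq]; simp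
  have h1 : hT.eigenvalues hn i * ‖x‖ ^ 2 ≤ inner ℝ (T x) x := by
    rw [hT.inner_apply_self_eq_sum hn, ← hna, Finset.mul_sum]
    refine Finset.sum_le_sum fun j _ => ?_
    rcases le_or_gt j i with hj | hj
    · exact mul_le_mul_of_nonneg_right (hT.eigenvalues_antitone hn hj) (sq_nonneg _)
    · have h0 : (hT.eigenvectorBasis hn).repr x j = 0 := ha j hj
      simp [a, h0]
  have h2 : inner ℝ (U x) x ≤ hU.eigenvalues hn i * ‖x‖ ^ 2 := by
    rw [hU.inner_apply_self_eq_sum hn, ← hnb, Finset.mul_sum]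
    refine Finset.sum_le_sum fun j _ => ?_
    rcases le_or_gt i j with hj | hj
    · exact mul_le_mul_of_nonneg_right (hU.eigenvalues_antitone hn hj) (sq_nonneg _)
    · have h0 : (hU.eigenvectorBasis hn).repr x j = 0 := hb j hj
      simp [b, h0]
  have hpos : 0 < ‖x‖ ^ 2 := by positivity
  exact le_of_mul_le_mul_right ((h1.trans (h x)).trans h2) hpos

open Matrix in
theorem sortedEigenvalues_le {n : ℕ} {A B : Matrix (Fin n) (Fin n) ℝ} (hA : A.IsHermitian)
    (hB : B.IsHermitian) (h : ∀ x : Fin n → ℝ, x ⬝ᵥ A *ᵥ x ≤ x ⬝ᵥ B *ᵥ x) (i : Fin n) :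
    sortedEigenvalues hA i ≤ sortedEigenvalues hB i := by
  refine LinearMap.IsSymmetric.eigenvalues_le_eigenvalues _ _ _ (fun x => ?_) _
  have := h (WithLp.ofLp x)
  simpa [EuclideanSpace.inner_eq_star_dotProduct, Matrix.toEuclideanLin] using this

open Matrix in
-- As a sum of squares indexed by `S`, the form is visibly nonnegative and monotone in `S`.
theorem dotProduct_nullMatrix_mulVec {n p m : ℕ} (Z : Matrix (Fin n) (Fin p) ℝ)
    (X : Matrix (Fin n) (Fin m) ℝ) (σ : Fin n → ℝ) (S : Finset (Fin m)) (x : Fin n → ℝ) :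
    x ⬝ᵥ nullMatrix Z X σ S *ᵥ x
      = ∑ j ∈ S, (Xᵀ *ᵥ ((1 - hatMatrix Z) *ᵥ (diagonal (fun i => √(σ i)) *ᵥ x))) j ^ 2 := by
  set D := diagonal (fun i => √(σ i)) with hD
  set P := 1 - hatMatrix Z with hP
  have hPt : Pᵀ = P := by simp [hP, hatMatrix_transpose]
  set y := P *ᵥ (D *ᵥ x) with hy
  have h1 : nullMatrix Z X σ S *ᵥ x = D *ᵥ (P *ᵥ (subDesign X S *ᵥ ((subDesign X S)ᵀ *ᵥ y))) := by
    simp [nullMatrix, hy, ← hD, ← hP, Matrix.mul_assoc]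
  have h2 : ∀ z, x ⬝ᵥ D *ᵥ (P *ᵥ z) = y ⬝ᵥ z := fun z => by
    rw [Matrix.dotProduct_mulVec, Matrix.dotProduct_mulVec, hy, ← Matrix.mulVec_transpose,
      ← Matrix.mulVec_transpose, hPt]
    simp [hD]
  rw [h1, h2, Matrix.dotProduct_mulVec, ← Matrix.mulVec_transpose, dotProduct,
    ← Finset.sum_coe_sort S]
  refine Finset.sum_congr rfl fun j _ => ?_
  rw [sq]
  rfl

theorem nullWeights_mono {n p m : ℕ} (Z : Matrix (Fin n) (Fin p) ℝ)
    (X : Matrix (Fin n) (Fin m) ℝ) (σ : Fin n → ℝ) {S T : Finset (Fin m)} (hST : S ⊆ T)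
    (i : Fin n) : nullWeights Z X σ S i ≤ nullWeights Z X σ T i := by
  refine sortedEigenvalues_le _ _ (fun x => ?_) i
  rw [dotProduct_nullMatrix_mulVec, dotProduct_nullMatrix_mulVec]
  exact Finset.sum_le_sum_of_subset_of_nonneg hST fun j _ _ => sq_nonneg _

theorem nullWeights_nonneg {n p m : ℕ} (Z : Matrix (Fin n) (Fin p) ℝ)
    (X : Matrix (Fin n) (Fin m) ℝ) (σ : Fin n → ℝ) (S : Finset (Fin m)) (i : Fin n) :
    0 ≤ nullWeights Z X σ S i := by
  have h : (nullMatrix Z X σ S).PosSemidef := by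
    refine Matrix.PosSemidef.of_dotProduct_mulVec_nonneg (nullMatrix_isHermitian Z X σ S) fun x => ?_
    rw [star_trivial, dotProduct_nullMatrix_mulVec]
    positivity
  -- `eigenvalues` reindexes `eigenvalues₀` by the inverse of this equivalence, which therefore
  -- cancels.
  have := h.eigenvalues_nonneg ((Fintype.equivOfCardEq (Fintype.card_fin _)) (Fin.cast (Fintype.card_fin n).symm i))
  simpa [Matrix.IsHermitian.eigenvalues, nullWeights, sortedEigenvalues] using this

/-! ### Existence and uniqueness of the majorizing vector -/

theorem IsMajorizingVector.antitone {n : ℕ} {up lo v : Fin n → ℝ} {ℓ : ℝ}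
    (h : IsMajorizingVector up lo ℓ v) : Antitone v := by
  obtain ⟨_, _, _, _, _, _, _, h, _⟩ := h
  exact h

theorem IsMajorizingVector.sum_eq {n : ℕ} {up lo v : Fin n → ℝ} {ℓ : ℝ}
    (h : IsMajorizingVector up lo ℓ v) : ∑ j, v j = ℓ := by
  obtain ⟨_, _, _, _, _, _, _, _, h⟩ := h
  exact h

theorem eq_of_le_of_sum_eq {n : ℕ} {v w : Fin n → ℝ} (h : v ≤ w) (hs : ∑ j, v j = ∑ j, w j) :
    v = w := by
  funext j
  exact (Finset.sum_eq_sum_iff_of_le fun j _ => h j).1 hs j (Finset.mem_univ j)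

/-- The vector with the earlier connecting index is entrywise below the other, so equal sums force
equality. With the same index, only that one entry could differ. -/
theorem IsMajorizingVector.unique {n : ℕ} {up lo v w : Fin n → ℝ} {ℓ : ℝ} (hle : lo ≤ up)
    (hv : IsMajorizingVector up lo ℓ v) (hw : IsMajorizingVector up lo ℓ w) : v = w := by
  have hs : ∑ j, v j = ∑ j, w j := hv.sum_eq.trans hw.sum_eq.symm
  obtain ⟨i, η, v1, v2, v3, v4, v5, -, -⟩ := hv
  obtain ⟨k, θ, w1, w2, w3, w4, w5, -, -⟩ := hw
  rcases lt_trichotomy i k with hik | rfl | hik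
  · refine eq_of_le_of_sum_eq (fun j => ?_) hs
    rcases lt_trichotomy j i with hj | rfl | hj
    · rw [v1 j hj, w1 j (hj.trans hik)]
    · rw [v2, w1 _ hik]; exact v5
    · rw [v3 j hj]
      rcases lt_trichotomy j k with hjk | rfl | hjk
      · rw [w1 j hjk]; exact hle j
      · rw [w2]; exact w4
      · rw [w3 j hjk]
  · funext j
    have hne : ∀ j, j ≠ i → v j = w j := fun j hj => by
      rcases hj.lt_or_gt with h | h
      · rw [v1 j h, w1 j h]
      · rw [v3 j h, w3 j h]
    by_cases hj : j = i
    · subst hj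
      rw [Fintype.sum_eq_add_sum_compl j, Fintype.sum_eq_add_sum_compl j,
        Finset.sum_congr rfl fun k hk => hne k (by simpa using hk)] at hs
      exact add_right_cancel hs
    · exact hne j hj
  · refine (eq_of_le_of_sum_eq (fun j => ?_) hs.symm).symm
    rcases lt_trichotomy j k with hj | rfl | hj
    · rw [w1 j hj, v1 j (hj.trans hik)]
    · rw [w2, v1 _ hik]; exact w5
    · rw [w3 j hj]
      rcases lt_trichotomy j i with hjk | rfl | hjk
      · rw [v1 j hjk]; exact hle j
      · rw [v2]; exact v4
      · rw [v3 j hjk]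

/-- A discrete intermediate value argument: replacing `lo` by `up` one entry at a time moves the sum
`T` from at most `ℓ` to at least `ℓ`. The first replacement that reaches `ℓ` fixes the index, and
the missing amount fixes the connecting entry. -/
theorem exists_isMajorizingVector {n : ℕ} (hn : 0 < n) {up lo : Fin n → ℝ} {ℓ : ℝ}
    (hup : Antitone up) (hlo : Antitone lo) (hle : lo ≤ up) (h1 : ∑ j, lo j ≤ ℓ)
    (h2 : ℓ ≤ ∑ j, up j) : ∃ v, IsMajorizingVector up lo ℓ v := by
  let T : ℕ → ℝ := fun i => ∑ j : Fin n, if j.1 < i then up j else lo j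
  have hT0 : T 0 ≤ ℓ := by simpa [T] using h1
  have hTn : ℓ ≤ T n := by simpa [T] using h2
  have hex : ∃ i, ℓ ≤ T (i + 1) := ⟨n - 1, by rwa [Nat.sub_add_cancel hn]⟩
  classical
  let i := Nat.find hex
  have hi : ℓ ≤ T (i + 1) := Nat.find_spec hex
  have hin : i < n := by
    have : i ≤ n - 1 := Nat.find_min' hex (by rwa [Nat.sub_add_cancel hn])
    omega
  have hTi : T i ≤ ℓ := by
    rcases Nat.eq_zero_or_pos i with h | h
    · rw [h]; exact hT0
    · have := Nat.find_min hex (m := i - 1) (by omega)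
      rw [Nat.sub_add_cancel h] at this
      exact (not_le.1 this).le
  let k : Fin n := ⟨i, hin⟩
  have hsplit : ∀ η, ∑ j : Fin n, (if j < k then up j else if j = k then η else lo j)
      = T i + (η - lo k) := fun η => by
    have : ∀ j : Fin n, (if j < k then up j else if j = k then η else lo j)
        = (if j.1 < i then up j else lo j) + if j = k then η - lo k else 0 := fun j => by
      rcases lt_trichotomy j k with h | h | h
      · have h' : j.1 < i := h
        simp [h, h', h.ne]
      · subst h; simp [k]
      · have h' : ¬ j.1 < i := not_lt.2 (le_of_lt h)
        simp [h.not_gt, h', h.ne']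
    rw [Finset.sum_congr rfl fun j _ => this j, Finset.sum_add_distrib]
    simp [T]
  have hTs : T (i + 1) = T i + (up k - lo k) := by
    rw [← hsplit]
    refine Finset.sum_congr rfl fun j _ => ?_
    rcases lt_trichotomy j k with h | h | h
    · have h' : j.1 < i := h
      simp [h, h'.le]
    · subst h; simp [k]
    · have h' : ¬ j.1 ≤ i := not_le.2 h
      simp [h.not_gt, h', h.ne']
  have hη1 : lo k ≤ lo k + (ℓ - T i) := by linarith
  have hη2 : lo k + (ℓ - T i) ≤ up k := by linarith
  refine ⟨fun j => if j < k then up j else if j = k then lo k + (ℓ - T i) else lo j,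
    k, lo k + (ℓ - T i), fun j hj => by simp [hj], by simp, fun j hj => by
      simp [hj.not_gt, hj.ne'], hη1, hη2, fun a b hab => ?_, ?_⟩
  · have ha := hup hab
    have hb := hlo hab
    have h3 := hle a
    have h3' := hle b
    rcases lt_trichotomy a k with h | rfl | h <;> rcases lt_trichotomy b k with h' | h' | h'
    · simpa [h, h'] using ha
    · subst h'; simp [h]; linarith
    · simp [h, h'.not_gt, h'.ne']; linarith
    · exact absurd (h'.trans_le hab) (lt_irrefl _)
    · subst h'; simp
    · simp [h'.not_gt, h'.ne']; linarith
    · exact absurd (h.trans_le hab) h'.not_gt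
    · subst h'; exact absurd h hab.not_gt
    · simpa [h.not_gt, h.ne', h'.not_gt, h'.ne'] using hb
  · rw [hsplit]; ring

/-- Entrywise comparison of the majorizing vector with a vector between the bounds: it dominates
the latter up to some index and is dominated after it. -/
theorem IsMajorizingVector.exists_crossing {n : ℕ} {up lo v w : Fin n → ℝ} {ℓ : ℝ}
    (hv : IsMajorizingVector up lo ℓ v) (h1 : lo ≤ w) (h2 : w ≤ up) :
    ∃ i, (∀ j, j < i → w j ≤ v j) ∧ ∀ j, i < j → v j ≤ w j := by
  obtain ⟨i, η, v1, -, v3, -⟩ := hv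
  exact ⟨i, fun j hj => (h2 j).trans (v1 j hj).ge, fun j hj => (v3 j hj).le.trans (h1 j)⟩

/-! ### Asymptotics of chi-square tails -/

open MeasureTheory ProbabilityTheory Filter Topology

/-- The survival function of `∑ j, z j ^ 2` for independent standard normal `z j`. -/
noncomputable def chiSqTail (ι : Type*) [Fintype ι] (u : ℝ) : ℝ :=
  (Measure.pi fun _ : ι => gaussianReal 0 1).real {x | u < ∑ j, x j ^ 2}

theorem pi_gaussianReal_eq_withDensity (ι : Type*) [Fintype ι] :
    (Measure.pi fun _ : ι => gaussianReal 0 1)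
      = (volume : Measure (ι → ℝ)).withDensity
          (fun x => ENNReal.ofReal (∏ j, gaussianPDFReal 0 1 (x j))) := by
  have hint : ∀ s : Set ℝ, MeasurableSet s → Integrable (s.indicator (gaussianPDFReal 0 1)) :=
    fun s hs => (integrable_gaussianPDFReal 0 1).indicator hs
  have hreal : ∀ s : Set ℝ, MeasurableSet s →
      gaussianReal 0 1 s = ENNReal.ofReal (∫ x, s.indicator (gaussianPDFReal 0 1) x) := by
    intro s hs
    rw [gaussianReal_apply_eq_integral _ one_ne_zero, integral_indicator hs]
  refine Measure.pi_eq (μ := fun _ : ι => gaussianReal 0 1) fun s hs => ?_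
  rw [withDensity_apply _ (MeasurableSet.univ_pi hs),
    ← lintegral_indicator (MeasurableSet.univ_pi hs)]
  have hpt : ∀ x : ι → ℝ, (Set.univ.pi s).indicator
      (fun x => ENNReal.ofReal (∏ j, gaussianPDFReal 0 1 (x j))) x
      = ENNReal.ofReal (∏ j, (s j).indicator (gaussianPDFReal 0 1) (x j)) := by
    intro x
    by_cases hx : x ∈ Set.univ.pi s
    · rw [Set.indicator_of_mem hx]
      congr 1
      exact Finset.prod_congr rfl fun j _ => (Set.indicator_of_mem (hx j trivial) _).symm
    · rw [Set.indicator_of_notMem hx]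
      obtain ⟨j, hj⟩ : ∃ j, x j ∉ s j := by simpa [Set.mem_pi] using hx
      rw [Finset.prod_eq_zero (Finset.mem_univ j) (Set.indicator_of_notMem hj _),
        ENNReal.ofReal_zero]
  simp_rw [hpt]
  have hnn : ∀ j (x : ℝ), 0 ≤ (s j).indicator (gaussianPDFReal 0 1) x := fun j x =>
    Set.indicator_nonneg (fun x _ => gaussianPDFReal_nonneg 0 1 x) x
  rw [← ofReal_integral_eq_lintegral_ofReal, integral_fintype_prod_volume_eq_prod
      (fun j => (s j).indicator (gaussianPDFReal 0 1)),
    ENNReal.ofReal_prod_of_nonneg fun j _ => integral_nonneg (hnn j)]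
  · exact Finset.prod_congr rfl fun j _ => (hreal _ (hs j)).symm
  · exact Integrable.fintype_prod (f := fun j => (s j).indicator (gaussianPDFReal 0 1))
      fun j => hint _ (hs j)
  · exact Eventually.of_forall fun x => Finset.prod_nonneg fun j _ => hnn j _

theorem prod_gaussianPDFReal (ι : Type*) [Fintype ι] (x : ι → ℝ) :
    ∏ j, gaussianPDFReal 0 1 (x j)
      = (√(2 * Real.pi))⁻¹ ^ Fintype.card ι * Real.exp (-(∑ j, x j ^ 2) / 2) := by
  simp only [gaussianPDFReal, NNReal.coe_one, mul_one, sub_zero]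
  rw [Finset.prod_mul_distrib, Finset.prod_const, Finset.card_univ, ← Real.exp_sum,
    ← Finset.sum_div, Finset.sum_neg_distrib]

/-- Polar coordinates for the rotation-invariant Gaussian density. The value of `K` is immaterial,
since only ratios of tails are used. -/
theorem chiSqTail_eq_integral (ι : Type*) [Fintype ι] [Nonempty ι] :
    ∃ K : ℝ, 0 < K ∧ ∀ u, 0 ≤ u → chiSqTail ι u
      = K * ∫ y in Set.Ioi √u, y ^ (Fintype.card ι - 1) * Real.exp (-y ^ 2 / 2) := by
  set E := EuclideanSpace ℝ ι
  have hdim : Module.finrank ℝ E = Fintype.card ι := by simp [E]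
  have hcard : 0 < Fintype.card ι := Fintype.card_pos
  have : Nontrivial E := Module.nontrivial_of_finrank_pos (R := ℝ) (by rw [hdim]; exact hcard)
  have hball : 0 < (volume : Measure E).real (Metric.ball 0 1) := by
    rw [Measure.real, ENNReal.toReal_pos_iff]
    exact ⟨Metric.measure_ball_pos _ _ one_pos, measure_ball_lt_top⟩
  have hc : 0 < (√(2 * Real.pi))⁻¹ ^ Fintype.card ι := by positivity
  refine ⟨Fintype.card ι * (volume : Measure E).real (Metric.ball 0 1)
    * (√(2 * Real.pi))⁻¹ ^ Fintype.card ι, by positivity, fun u hu => ?_⟩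
  let f : ℝ → ℝ := (Set.Ioi √u).indicator fun y =>
    (√(2 * Real.pi))⁻¹ ^ Fintype.card ι * Real.exp (-y ^ 2 / 2)
  have hmeas : MeasurableSet {x : ι → ℝ | u < ∑ j, x j ^ 2} :=
    measurableSet_lt measurable_const (by fun_prop)
  have h1 : chiSqTail ι u = ∫ x : E, f ‖x‖ := by
    rw [chiSqTail, Measure.real, pi_gaussianReal_eq_withDensity, withDensity_apply _ hmeas,
      ← integral_eq_lintegral_of_nonneg_ae, ← integral_indicator hmeas,
      ← (PiLp.volume_preserving_ofLp ι).integral_comp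
        (MeasurableEquiv.toLp 2 (ι → ℝ)).symm.measurableEmbedding]
    · refine integral_congr_ae (Eventually.of_forall fun x => ?_)
      have hx : ∑ j, x j ^ 2 = ‖x‖ ^ 2 := by rw [EuclideanSpace.norm_sq_eq]; simp
      have hiff : u < ‖x‖ ^ 2 ↔ √u < ‖x‖ :=
        ⟨fun h => by simpa [Real.sqrt_sq (norm_nonneg x)] using Real.sqrt_lt_sqrt hu h,
          Real.lt_sq_of_sqrt_lt⟩
      simp only [f, Set.indicator, Set.mem_ofPred_eq, Set.mem_Ioi, prod_gaussianPDFReal, hx, hiff]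
    · exact Eventually.of_forall fun x =>
        Finset.prod_nonneg fun j _ => gaussianPDFReal_nonneg 0 1 _
    · exact (Measurable.aestronglyMeasurable (by fun_prop))
  rw [h1, integral_fun_norm_addHaar volume f, hdim, nsmul_eq_mul, smul_eq_mul, mul_assoc, mul_assoc]
  congr 2
  rw [← integral_const_mul]
  have : ∀ y, y ^ (Fintype.card ι - 1) • f y = (Set.Ioi √u).indicator (fun y =>
      (√(2 * Real.pi))⁻¹ ^ Fintype.card ι * (y ^ (Fintype.card ι - 1) * Real.exp (-y ^ 2 / 2))) y := by
    intro y
    simp only [f, Set.indicator, smul_eq_mul]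
    split_ifs
    · ring
    · simp
  simp_rw [this]
  rw [setIntegral_indicator measurableSet_Ioi]
  congr 2
  exact Set.inter_eq_right.2 (Set.Ioi_subset_Ioi (Real.sqrt_nonneg u))

theorem integrableOn_pow_mul_exp_neg_sq (k : ℕ) :
    IntegrableOn (fun y : ℝ => y ^ k * Real.exp (-y ^ 2 / 2)) (Set.Ioi 0) := by
  have := integrableOn_rpow_mul_exp_neg_mul_sq (b := 1 / 2) (by norm_num) (s := k)
    (by have : (0:ℝ) ≤ k := k.cast_nonneg
        linarith)
  refine this.congr_fun (fun y _ => ?_) measurableSet_Ioi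
  simp only [Real.rpow_natCast]
  congr 2
  ring

theorem hasDerivAt_integral_Ioi_sqrt (k : ℕ) {u : ℝ} (hu : 0 < u) :
    HasDerivAt (fun u => ∫ y in Set.Ioi √u, y ^ k * Real.exp (-y ^ 2 / 2))
      (-(√u ^ k * Real.exp (-u / 2)) * (1 / (2 * √u))) u := by
  set g : ℝ → ℝ := fun y => y ^ k * Real.exp (-y ^ 2 / 2) with hg
  have hcont : Continuous g := by fun_prop
  have h1 : HasDerivAt (fun x => (∫ y in Set.Ioi 0, g y) - ∫ y in (0:ℝ)..x, g y) (-g √u) √u := by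
    exact (intervalIntegral.integral_hasDerivAt_right (hcont.intervalIntegrable _ _)
      (hcont.stronglyMeasurableAtFilter _ _) hcont.continuousAt).const_sub _
  have h2 := h1.comp u (Real.hasDerivAt_sqrt hu.ne')
  have hgu : g √u = √u ^ k * Real.exp (-u / 2) := by
    simp only [hg, Real.sq_sqrt hu.le]
  rw [hgu] at h2
  refine h2.congr_of_eventuallyEq ?_
  filter_upwards [eventually_gt_nhds hu] with x hx
  have := intervalIntegral.integral_Ioi_sub_Ioi (f := g) (μ := volume)
    (integrableOn_pow_mul_exp_neg_sq k) (Real.sqrt_nonneg x)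
  simp only [Function.comp]
  linarith

theorem tendsto_integral_Ioi_sqrt (k : ℕ) :
    Tendsto (fun u => ∫ y in Set.Ioi √u, y ^ k * Real.exp (-y ^ 2 / 2)) atTop (𝓝 0) := by
  have h1 := intervalIntegral_tendsto_integral_Ioi 0 (integrableOn_pow_mul_exp_neg_sq k)
    Real.tendsto_sqrt_atTop
  have h2 := h1.const_sub (∫ y in Set.Ioi 0, (y:ℝ) ^ k * Real.exp (-y ^ 2 / 2))
  rw [sub_self] at h2
  refine h2.congr fun x => ?_
  have := intervalIntegral.integral_Ioi_sub_Ioi (μ := volume)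
    (integrableOn_pow_mul_exp_neg_sq k) (Real.sqrt_nonneg x)
  linarith

/-- L'Hôpital: the ratio of derivatives is exp(b/2) times powers of √((u - b)/u), which tend to 1.
-/
theorem tendsto_chiSqTail_sub_div (ι : Type*) [Fintype ι] [Nonempty ι] (b : ℝ) :
    Tendsto (fun u => chiSqTail ι (u - b) / chiSqTail ι u) atTop (𝓝 (Real.exp (b / 2))) := by
  obtain ⟨K, hK, h⟩ := chiSqTail_eq_integral ι
  set k := Fintype.card ι - 1
  set F : ℝ → ℝ := fun u => ∫ y in Set.Ioi √u, y ^ k * Real.exp (-y ^ 2 / 2)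
  have hsub : Tendsto (fun u : ℝ => u - b) atTop atTop := tendsto_atTop_add_const_right _ _ tendsto_id
  suffices hlim : Tendsto (fun u => F (u - b) / F u) atTop (𝓝 (Real.exp (b / 2))) by
    refine hlim.congr' ?_
    filter_upwards [eventually_ge_atTop 0, hsub.eventually_ge_atTop 0] with u h1 h2
    rw [h u h1, h _ h2, mul_div_mul_left _ _ hK.ne']
  refine HasDerivAt.lhopital_zero_atTop
    (f' := fun u => -(√(u - b) ^ k * Real.exp (-(u - b) / 2)) * (1 / (2 * √(u - b))))
    (g' := fun u => -(√u ^ k * Real.exp (-u / 2)) * (1 / (2 * √u))) ?_ ?_ ?_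
    ((tendsto_integral_Ioi_sqrt k).comp hsub) (tendsto_integral_Ioi_sqrt k) ?_
  · filter_upwards [hsub.eventually_gt_atTop 0] with u hu
    exact (hasDerivAt_integral_Ioi_sqrt k hu).comp_sub_const u b
  · filter_upwards [eventually_gt_atTop 0] with u hu using hasDerivAt_integral_Ioi_sqrt k hu
  · filter_upwards [eventually_gt_atTop 0] with u hu
    have : 0 < √u := Real.sqrt_pos.2 hu
    exact (mul_neg_of_neg_of_pos (neg_neg_of_pos (by positivity)) (by positivity)).ne
  · have hq : Tendsto (fun u : ℝ => √((u - b) / u)) atTop (𝓝 1) := by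
      have : Tendsto (fun u : ℝ => 1 - b / u) atTop (𝓝 1) := by
        simpa using (tendsto_const_nhds (x := b)).div_atTop tendsto_id |>.const_sub 1
      have := this.sqrt
      rw [Real.sqrt_one] at this
      refine this.congr' ?_
      filter_upwards [eventually_gt_atTop 0] with u hu
      congr 1
      field_simp
    have := ((hq.pow k).mul (hq.inv₀ one_ne_zero)).mul_const (Real.exp (b / 2))
    simp only [one_pow, inv_one, one_mul] at this
    refine this.congr' ?_
    filter_upwards [eventually_gt_atTop 0, hsub.eventually_gt_atTop 0] with u hu hub
    have h1 : 0 < √u := Real.sqrt_pos.2 hu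
    have h2 : 0 < √(u - b) := Real.sqrt_pos.2 hub
    have h3 : Real.exp (-(u - b) / 2) = Real.exp (-u / 2) * Real.exp (b / 2) := by
      rw [← Real.exp_add]; congr 1; ring
    rw [Real.sqrt_div hub.le, h3, div_pow]
    field_simp

/-! ### Tails with an exponential rate and their perturbation -/

theorem chiSqTail_nonneg (ι : Type*) [Fintype ι] (u : ℝ) : 0 ≤ chiSqTail ι u :=
  measureReal_nonneg

theorem chiSqTail_antitone (ι : Type*) [Fintype ι] : Antitone (chiSqTail ι) := fun _ _ h =>
  measureReal_mono fun _ hx => lt_of_le_of_lt h hx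

/-- A positive survival function with asymptotic exponential rate `γ`. -/
structure IsExpTail (γ : ℝ) (g : ℝ → ℝ) : Prop where
  antitone : Antitone g
  nonneg : ∀ t, 0 ≤ g t
  le_one : ∀ t, g t ≤ 1
  tendsto : ∀ b, Tendsto (fun t => g (t - b) / g t) atTop (𝓝 (Real.exp (γ * b)))

theorem isExpTail_chiSqTail (ι : Type*) [Fintype ι] [Nonempty ι] {μ : ℝ} (hμ : 0 < μ) :
    IsExpTail (1 / (2 * μ)) fun t => chiSqTail ι (t / μ) where
  antitone := (chiSqTail_antitone ι).comp_monotone fun _ _ h => by gcongr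
  nonneg _ := chiSqTail_nonneg ι _
  le_one _ := measureReal_le_one
  tendsto b := by
    have := (tendsto_chiSqTail_sub_div ι (b / μ)).comp (tendsto_id.atTop_div_const hμ)
    convert this using 2
    · simp [sub_div]
    · congr 1; field_simp

/-- A zero would persist to the right, making the ratios for b = 0 equal to 0/0 = 0, whereas their
limit is 1. -/
theorem IsExpTail.pos {γ : ℝ} {g : ℝ → ℝ} (hg : IsExpTail γ g) (t : ℝ) : 0 < g t := by
  refine (hg.nonneg t).lt_of_ne fun h => ?_
  have h0 : Tendsto (fun s => g (s - 0) / g s) atTop (𝓝 0) := by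
    refine tendsto_const_nhds.congr' ?_
    filter_upwards [eventually_ge_atTop t] with s hs
    rw [le_antisymm ((hg.antitone hs).trans h.ge) (hg.nonneg s), div_zero]
  exact (Real.exp_pos _).ne (tendsto_nhds_unique h0 (hg.tendsto 0))

/-- A bound uniform in `b`, serving as the majorant for dominated convergence: past `U` each unit
step costs at most a factor exp(s), and such steps are iterated. -/
theorem IsExpTail.exists_le_exp_mul {γ s : ℝ} {g : ℝ → ℝ} (hg : IsExpTail γ g) (hs : γ < s)
    (hs0 : 0 ≤ s) :
    ∃ C U : ℝ, 0 < C ∧ ∀ t, U ≤ t → ∀ b, 0 ≤ b → g (t - b) ≤ C * Real.exp (s * b) * g t := by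
  have h1 : ∀ᶠ t in atTop, g (t - 1) ≤ Real.exp s * g t := by
    have := (hg.tendsto 1).eventually_lt_const (Real.exp_lt_exp.2 (by simpa using hs))
    filter_upwards [this] with t ht
    exact (div_le_iff₀ (hg.pos t)).1 ht.le
  obtain ⟨U, hU⟩ := eventually_atTop.1 h1
  -- This makes `C * g t ≥ 1` for `t ≤ U + 1`, where unit steps are no longer controlled and `g ≤ 1`
  -- has to suffice.
  set C := (g (U + 1))⁻¹
  have hC : 0 < C := inv_pos.2 (hg.pos _)
  have hC1 : 1 ≤ C := (one_le_inv₀ (hg.pos _)).2 (hg.le_one _)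
  have key : ∀ n : ℕ, ∀ t, U ≤ t → g (t - n) ≤ C * Real.exp (s * n) * g t := by
    intro n
    induction n with
    | zero => intro t _; simpa using le_mul_of_one_le_left (hg.nonneg t) hC1
    | succ n ih =>
      intro t ht
      rcases le_or_gt (U + 1) t with h | h
      · calc g (t - (n + 1 : ℕ)) = g (t - 1 - n) := by push_cast; ring_nf
          _ ≤ C * Real.exp (s * n) * g (t - 1) := ih _ (by linarith)
          _ ≤ C * Real.exp (s * n) * (Real.exp s * g t) := by gcongr; exact hU t ht
          _ = C * Real.exp (s * (n + 1 : ℕ)) * g t := by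
            push_cast; rw [mul_add, Real.exp_add, mul_one]; ring
      · have h2 : 1 ≤ Real.exp (s * (n + 1 : ℕ)) := Real.one_le_exp (by positivity)
        have h3 : 1 ≤ C * g t := by
          rw [inv_mul_eq_div, one_le_div (hg.pos _)]; exact hg.antitone h.le
        calc g (t - (n + 1 : ℕ)) ≤ 1 := hg.le_one _
          _ ≤ (C * g t) * Real.exp (s * (n + 1 : ℕ)) := one_le_mul_of_one_le_of_one_le h3 h2
          _ = _ := by ring
  refine ⟨C * Real.exp s, U, by positivity, fun t ht b hb => ?_⟩
  have hceil := Nat.ceil_lt_add_one hb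
  calc g (t - b) ≤ g (t - ⌈b⌉₊) := hg.antitone (by linarith [Nat.le_ceil b])
    _ ≤ C * Real.exp (s * ⌈b⌉₊) * g t := key _ _ ht
    _ ≤ C * Real.exp (s * (b + 1)) * g t := by have := hg.nonneg t; gcongr
    _ = _ := by rw [mul_add, Real.exp_add, mul_one]; ring

/-- Perturbing a survival function with exponential rate `γ` by independent nonnegative summands
`B` and `B'`, the larger exponential moment of order `γ` wins eventually. -/
theorem IsExpTail.eventually_lintegral_le {γ s : ℝ} {g : ℝ → ℝ} (hg : IsExpTail γ g) (hs : γ < s)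
    (hs0 : 0 ≤ s) {Y : Type*} [MeasurableSpace Y] {ν : Measure Y} {B B' : Y → ℝ}
    (hB : Measurable B) (hB' : Measurable B') (hB0 : ∀ y, 0 ≤ B y)
    (hfin : ∫⁻ y, ENNReal.ofReal (Real.exp (s * B y)) ∂ν ≠ ⊤)
    (hlt : ∫⁻ y, ENNReal.ofReal (Real.exp (γ * B y)) ∂ν
      < ∫⁻ y, ENNReal.ofReal (Real.exp (γ * B' y)) ∂ν) :
    ∀ᶠ t in atTop, ∫⁻ y, ENNReal.ofReal (g (t - B y)) ∂ν
      ≤ ∫⁻ y, ENNReal.ofReal (g (t - B' y)) ∂ν := by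
  obtain ⟨C, U, hC, hCU⟩ := hg.exists_le_exp_mul hs hs0
  have hgm : Measurable g := hg.antitone.measurable
  let F : (Y → ℝ) → ℝ → Y → ENNReal := fun b t y => ENNReal.ofReal (g (t - b y) / g t)
  have hFm : ∀ b, Measurable b → ∀ t, Measurable (F b t) := fun b hb t => by
    have : Measurable fun y => g (t - b y) := hgm.comp (measurable_const.sub hb)
    exact (this.div_const _).ennreal_ofReal
  have hFt : ∀ (b : Y → ℝ) y,
      Tendsto (fun t => F b t y) atTop (𝓝 (ENNReal.ofReal (Real.exp (γ * b y)))) := fun b y =>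
    ENNReal.tendsto_ofReal (hg.tendsto (b y))
  have hmul : ∀ b, Measurable b → ∀ t, ∫⁻ y, ENNReal.ofReal (g (t - b y)) ∂ν
      = ENNReal.ofReal (g t) * ∫⁻ y, F b t y ∂ν := fun b hb t => by
    rw [← lintegral_const_mul _ (hFm b hb t)]
    refine lintegral_congr fun y => ?_
    rw [← ENNReal.ofReal_mul (hg.nonneg t), mul_div_cancel₀ _ (hg.pos t).ne']
  have hlim : Tendsto (fun t => ∫⁻ y, F B t y ∂ν) atTop
      (𝓝 (∫⁻ y, ENNReal.ofReal (Real.exp (γ * B y)) ∂ν)) := by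
    refine tendsto_lintegral_filter_of_dominated_convergence
      (fun y => ENNReal.ofReal C * ENNReal.ofReal (Real.exp (s * B y)))
      (Eventually.of_forall (hFm B hB)) ?_ ?_ (Eventually.of_forall (hFt B))
    · filter_upwards [eventually_ge_atTop U] with t ht
      refine Eventually.of_forall fun y => ?_
      rw [← ENNReal.ofReal_mul hC.le]
      exact ENNReal.ofReal_le_ofReal ((div_le_iff₀ (hg.pos t)).2 (hCU t ht _ (hB0 y)))
    · rw [lintegral_const_mul _ (by fun_prop)]
      exact ENNReal.mul_ne_top ENNReal.ofReal_ne_top hfin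
  -- Fatou suffices for `B'` and allows its moment to be infinite.
  have hfatou : ∫⁻ y, ENNReal.ofReal (Real.exp (γ * B' y)) ∂ν
      ≤ liminf (fun t => ∫⁻ y, F B' t y ∂ν) atTop := by
    refine le_trans (le_of_eq ?_) (lintegral_liminf_le (hFm B' hB'))
    exact lintegral_congr fun y => (hFt B' y).liminf_eq.symm
  obtain ⟨c, hc1, hc2⟩ := exists_between hlt
  filter_upwards [hlim.eventually_lt_const hc1,
    eventually_lt_of_lt_liminf (hc2.trans_le hfatou)] with t h1 h2
  rw [hmul B hB, hmul B' hB']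
  exact mul_le_mul' le_rfl (h1.trans h2).le

/-! ### Conditioning on coordinates and exponential moments of Gaussian squares -/

/-- Fubini, conditioning on the coordinates outside `p`. Other coordinates may also have weight `μ`,
so one `p` can serve two weight vectors. -/
theorem pi_gaussianReal_tail_eq_lintegral {ι : Type*} [Fintype ι] (p : ι → Prop) [DecidablePred p]
    {μ : ℝ} (hμ : 0 < μ) {w : ι → ℝ} (hw : ∀ j, p j → w j = μ) (t : ℝ) :
    (Measure.pi fun _ : ι => gaussianReal 0 1) {z | t < ∑ j, w j * z j ^ 2}
      = ∫⁻ y, ENNReal.ofReal (chiSqTail {j // p j} ((t - ∑ j : {j // ¬ p j}, w j * y j ^ 2) / μ))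
          ∂(Measure.pi fun _ : {j // ¬ p j} => gaussianReal 0 1) := by
  have hmp := measurePreserving_piEquivPiSubtypeProd (fun _ : ι => gaussianReal 0 1) p
  set S : Set (({j // p j} → ℝ) × ({j // ¬ p j} → ℝ)) :=
    {q | t < ∑ j, μ * q.1 j ^ 2 + ∑ j : {j // ¬ p j}, w j * q.2 j ^ 2} with hS
  have hSm : MeasurableSet S := measurableSet_lt measurable_const (by fun_prop)
  have hpre : {z : ι → ℝ | t < ∑ j, w j * z j ^ 2}
      = (MeasurableEquiv.piEquivPiSubtypeProd (fun _ => ℝ) p) ⁻¹' S := by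
    ext z
    simp only [hS, Set.mem_preimage, Set.mem_ofPred_eq]
    rw [← Fintype.sum_subtype_add_sum_subtype p fun j => w j * z j ^ 2]
    have : ∑ j : {j // p j}, w j * z j ^ 2 = ∑ j : {j // p j}, μ * z j ^ 2 :=
      Finset.sum_congr rfl fun j _ => by rw [hw j j.2]
    rw [this]
    rfl
  rw [hpre, hmp.measure_preimage hSm.nullMeasurableSet, Measure.prod_apply_symm hSm]
  refine lintegral_congr fun y => ?_
  rw [chiSqTail, ofReal_measureReal]
  congr 1
  ext x
  simp only [hS, Set.mem_preimage, Set.mem_ofPred_eq, ← Finset.mul_sum]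
  rw [div_lt_iff₀ hμ, sub_lt_iff_lt_add, mul_comm]

theorem lintegral_exp_sum_sq {ι : Type*} [Fintype ι] (a : ι → ℝ) :
    ∫⁻ y, ENNReal.ofReal (Real.exp (∑ j, a j * y j ^ 2))
        ∂(Measure.pi fun _ : ι => gaussianReal 0 1)
      = ∏ j, ∫⁻ x, ENNReal.ofReal (Real.exp (a j * x ^ 2)) ∂(gaussianReal 0 1) := by
  have hm : ∀ j, Measurable fun x : ℝ => ENNReal.ofReal (Real.exp (a j * x ^ 2)) := fun j => by
    fun_prop
  have h := lintegral_prod_eq_prod_lintegral_of_indepFun Finset.univ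
    (fun j (y : ι → ℝ) => ENNReal.ofReal (Real.exp (a j * y j ^ 2)))
    (iIndepFun_pi (μ := fun _ : ι => gaussianReal 0 1) fun j => (hm j).aemeasurable)
    (fun j => (hm j).comp (measurable_pi_apply j))
  calc _ = _ := lintegral_congr fun y => by
        rw [Real.exp_sum, ENNReal.ofReal_prod_of_nonneg fun j _ => (Real.exp_pos _).le]
    _ = _ := h
    _ = _ := Finset.prod_congr rfl fun j _ =>
        (measurePreserving_eval (fun _ : ι => gaussianReal 0 1) j).lintegral_comp (hm j)

theorem lintegral_exp_mul_sq_gaussianReal (a : ℝ) :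
    ∫⁻ x, ENNReal.ofReal (Real.exp (a * x ^ 2)) ∂(gaussianReal 0 1)
      = ∫⁻ x, ENNReal.ofReal ((√(2 * Real.pi))⁻¹ * Real.exp (-(1 / 2 - a) * x ^ 2)) := by
  rw [gaussianReal_of_var_ne_zero _ one_ne_zero,
    lintegral_withDensity_eq_lintegral_mul _ (measurable_gaussianPDF 0 1) (by fun_prop)]
  refine lintegral_congr fun x => ?_
  rw [Pi.mul_apply, gaussianPDF, ← ENNReal.ofReal_mul (gaussianPDFReal_nonneg _ _ _)]
  simp only [gaussianPDFReal, NNReal.coe_one, mul_one, sub_zero]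
  rw [mul_assoc, ← Real.exp_add]
  ring_nf

/-- The value (1 - 2a)^(-1/2) is kept in exponential form so that products over coordinates become
sums of logarithms. -/
theorem lintegral_exp_mul_sq_of_lt {a : ℝ} (ha : a < 1 / 2) :
    ∫⁻ x, ENNReal.ofReal (Real.exp (a * x ^ 2)) ∂(gaussianReal 0 1)
      = ENNReal.ofReal (Real.exp (-(1 / 2) * Real.log (1 - 2 * a))) := by
  rw [lintegral_exp_mul_sq_gaussianReal, ← ofReal_integral_eq_lintegral_ofReal
    ((integrable_exp_neg_mul_sq (by linarith)).const_mul _)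
    (Eventually.of_forall fun x => by positivity), integral_const_mul, integral_gaussian]
  congr 1
  have h : 0 < 1 - 2 * a := by linarith
  rw [← Real.sqrt_inv, ← Real.sqrt_mul (by positivity), mul_comm (-(1 / 2)), ← Real.rpow_def_of_pos h,
    Real.rpow_neg h.le, ← Real.sqrt_eq_rpow, ← Real.sqrt_inv]
  congr 1
  have : (1 / 2 - a) ≠ 0 := by linarith
  field_simp

theorem lintegral_exp_mul_sq_of_ge {a : ℝ} (ha : 1 / 2 ≤ a) :
    ∫⁻ x, ENNReal.ofReal (Real.exp (a * x ^ 2)) ∂(gaussianReal 0 1) = ⊤ := by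
  rw [lintegral_exp_mul_sq_gaussianReal, eq_top_iff]
  calc (⊤ : ENNReal) = ∫⁻ _ : ℝ, ENNReal.ofReal (√(2 * Real.pi))⁻¹ := by
        rw [lintegral_const, Real.volume_univ, ENNReal.mul_top]
        simp [Real.pi_pos]
    _ ≤ _ := lintegral_mono fun x => ENNReal.ofReal_le_ofReal <|
        le_mul_of_one_le_right (by positivity) (Real.one_le_exp (by nlinarith [sq_nonneg x]))

/-- Excludes 0 · ∞ = 0 in a product with an infinite factor. -/
theorem lintegral_exp_mul_sq_ne_zero (a : ℝ) :
    ∫⁻ x, ENNReal.ofReal (Real.exp (a * x ^ 2)) ∂(gaussianReal 0 1) ≠ 0 := by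
  rcases lt_or_ge a (1 / 2) with h | h
  · rw [lintegral_exp_mul_sq_of_lt h]
    simp [Real.exp_pos]
  · simp [lintegral_exp_mul_sq_of_ge h]

theorem lintegral_exp_sum_sq_of_lt {ι : Type*} [Fintype ι] {a : ι → ℝ} (ha : ∀ j, a j < 1 / 2) :
    ∫⁻ y, ENNReal.ofReal (Real.exp (∑ j, a j * y j ^ 2))
        ∂(Measure.pi fun _ : ι => gaussianReal 0 1)
      = ENNReal.ofReal (Real.exp (-(1 / 2) * ∑ j, Real.log (1 - 2 * a j))) := by
  rw [lintegral_exp_sum_sq, Finset.mul_sum, Real.exp_sum,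
    ENNReal.ofReal_prod_of_nonneg fun j _ => (Real.exp_pos _).le]
  exact Finset.prod_congr rfl fun j _ => lintegral_exp_mul_sq_of_lt (ha j)

theorem lintegral_exp_sum_sq_of_ge {ι : Type*} [Fintype ι] {a : ι → ℝ} {k : ι}
    (ha : 1 / 2 ≤ a k) :
    ∫⁻ y, ENNReal.ofReal (Real.exp (∑ j, a j * y j ^ 2))
        ∂(Measure.pi fun _ : ι => gaussianReal 0 1) = ⊤ := by
  classical
  rw [lintegral_exp_sum_sq, Fintype.prod_eq_mul_prod_compl k, lintegral_exp_mul_sq_of_ge ha]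
  exact ENNReal.top_mul (Finset.prod_ne_zero_iff.2 fun j _ => lintegral_exp_mul_sq_ne_zero _)

/-! ### Eventual comparison of the tails of weighted sums -/

theorem eq_of_le_of_crossing {n : ℕ} {w v : Fin n → ℝ} {i : Fin n} (hs : ∑ j, w j = ∑ j, v j)
    (hle : ∀ j, j ≤ i → v j ≤ w j) (h2 : ∀ j, i < j → v j ≤ w j) : v = w :=
  eq_of_le_of_sum_eq (fun j => (le_or_gt j i).elim (hle j) (h2 j)) hs.symm

/-- The terms of a given weight in a nonnegatively weighted sum bound its tail from below. -/
theorem ofReal_chiSqTail_le_tail {n : ℕ} {v : Fin n → ℝ} (hv0 : ∀ j, 0 ≤ v j) {k : Fin n}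
    (hk : 0 < v k) (t : ℝ) :
    ENNReal.ofReal (chiSqTail {j // v j = v k} (t / v k))
      ≤ (Measure.pi fun _ : Fin n => gaussianReal 0 1) {z | t < ∑ j, v j * z j ^ 2} := by
  rw [pi_gaussianReal_tail_eq_lintegral (fun j => v j = v k) hk (fun j h => h)]
  have hconst : ENNReal.ofReal (chiSqTail {j // v j = v k} (t / v k))
      = ∫⁻ _, ENNReal.ofReal (chiSqTail {j // v j = v k} (t / v k))
          ∂(Measure.pi fun _ : {j // ¬ v j = v k} => gaussianReal 0 1) := by simp
  rw [hconst]
  refine lintegral_mono fun y => ENNReal.ofReal_le_ofReal (chiSqTail_antitone _ ?_)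
  have : 0 ≤ ∑ j : {j // ¬ v j = v k}, v j * y j ^ 2 :=
    Finset.sum_nonneg fun j _ => mul_nonneg (hv0 j) (sq_nonneg _)
  gcongr
  linarith

/-- If the leading weight of `v` is strictly larger than that of `w`, the tail of the weighted sum
for `v` dominates eventually. -/
theorem eventually_tail_le_of_lt {n : ℕ} {w v : Fin n → ℝ} (k : Fin n) (hw0 : ∀ j, 0 ≤ w j)
    (hv0 : ∀ j, 0 ≤ v j) (hk : ∀ j, w j ≤ w k) (hlt : w k < v k) :
    ∀ᶠ t in atTop, (Measure.pi fun _ : Fin n => gaussianReal 0 1) {z | t < ∑ j, w j * z j ^ 2}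
      ≤ (Measure.pi fun _ : Fin n => gaussianReal 0 1) {z | t < ∑ j, v j * z j ^ 2} := by
  set P := Measure.pi fun _ : Fin n => gaussianReal 0 1
  set μ := v k
  have hμ : 0 < μ := (hw0 k).trans_lt hlt
  have : Nonempty {j // v j = v k} := ⟨⟨k, rfl⟩⟩
  set g : ℝ → ℝ := fun t => chiSqTail {j // v j = v k} (t / μ)
  have hg : IsExpTail (1 / (2 * μ)) g := isExpTail_chiSqTail _ hμ
  -- A rate strictly above that of `v`, yet with s · w_j < 1/2 for all j, so the moment of order `s`
  -- for `w` is finite.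
  set s := 1 / (μ + w k)
  have hμw : 0 < μ + w k := by linarith [hw0 k]
  have hγs : 1 / (2 * μ) < s := one_div_lt_one_div_of_lt hμw (by linarith)
  have hγ : 0 < 1 / (2 * μ) := by positivity
  obtain ⟨s', hs', hs's⟩ := exists_between hγs
  have hsw : ∀ j, s * w j < 1 / 2 := fun j => by
    rw [one_div_mul_eq_div, div_lt_div_iff₀ hμw two_pos]
    linarith [hk j]
  obtain ⟨C, U, hC, hCU⟩ := hg.exists_le_exp_mul hs' (hγ.trans hs').le
  set M := ∫⁻ y, ENNReal.ofReal (Real.exp (∑ j, s * w j * y j ^ 2)) ∂P with hM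
  have hMtop : M ≠ ⊤ := by
    rw [hM, lintegral_exp_sum_sq_of_lt hsw]
    exact ENNReal.ofReal_ne_top
  have hlow : ∀ t, ENNReal.ofReal (g t) ≤ P {z | t < ∑ j, v j * z j ^ 2} :=
    ofReal_chiSqTail_le_tail hv0 hμ
  -- Chernoff bound.
  have hup : ∀ t, P {z | t < ∑ j, w j * z j ^ 2} ≤ ENNReal.ofReal (Real.exp (-(s * t)) * M.toReal) := by
    intro t
    have hs0 : 0 < s := hγ.trans hγs
    rw [ENNReal.ofReal_mul (Real.exp_pos _).le, ENNReal.ofReal_toReal hMtop, hM,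
      ← lintegral_const_mul _ (by fun_prop)]
    have hset : MeasurableSet {z : Fin n → ℝ | t < ∑ j, w j * z j ^ 2} :=
      measurableSet_lt measurable_const (by fun_prop)
    rw [← lintegral_indicator_one hset]
    refine lintegral_mono fun z => ?_
    refine Set.indicator_apply_le' (fun hz => ?_) fun _ => zero_le
    rw [Pi.one_apply, ← ENNReal.ofReal_mul (Real.exp_pos _).le, ← Real.exp_add,
      ← ENNReal.ofReal_one]
    refine ENNReal.ofReal_le_ofReal (Real.one_le_exp ?_)
    have : ∑ j, s * w j * z j ^ 2 = s * ∑ j, w j * z j ^ 2 := by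
      rw [Finset.mul_sum]; exact Finset.sum_congr rfl fun j _ => mul_assoc _ _ _
    rw [this]
    have := mul_lt_mul_of_pos_left (show t < ∑ j, w j * z j ^ 2 from hz) hs0
    linarith
  have hlim : Tendsto (fun t => Real.exp (-((s - s') * t)) * (M.toReal * C * Real.exp (-(s' * U))))
      atTop (𝓝 0) := by
    have h1 : Tendsto (fun t => (s - s') * t) atTop atTop :=
      tendsto_id.const_mul_atTop (sub_pos.2 hs's)
    simpa using (Real.tendsto_exp_neg_atTop_nhds_zero.comp h1).mul_const
      (M.toReal * C * Real.exp (-(s' * U)))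
  filter_upwards [hlim.eventually_lt_const (hg.pos U), eventually_ge_atTop U] with t ht htU
  refine (hup t).trans (le_trans (ENNReal.ofReal_le_ofReal ?_) (hlow t))
  -- Shifting back to the fixed point `U` turns the growth bound into a lower bound on `g t` of
  -- order exp(-s't), with s' < s.
  have h1 := hCU t htU (t - U) (sub_nonneg.2 htU)
  rw [sub_sub_cancel] at h1
  have h2 := ht.le.trans h1
  have e1 : Real.exp (-((s - s') * t)) = Real.exp (-(s * t)) * Real.exp (s' * t) := by
    rw [← Real.exp_add]; congr 1; ring
  have e2 : Real.exp (s' * (t - U)) = Real.exp (s' * t) * Real.exp (-(s' * U)) := by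
    rw [← Real.exp_add]; congr 1; ring
  have e3 : 0 < C * (Real.exp (s' * t) * Real.exp (-(s' * U))) := by positivity
  rw [e1, e2] at h2
  refine le_of_mul_le_mul_left ?_ e3
  linarith

/-- Strict Karamata inequality for `x ↦ -log (1 - x / μ)` and vectors with a single crossing. -/
theorem sum_log_lt_sum_log {ι κ : Type*} [LinearOrder ι] [Fintype κ] (e : κ → ι) {w v : ι → ℝ}
    {μ : ℝ} {i : ι} (hμ : 0 < μ) (hw : Antitone w) (hwi : w i < μ) (hwμ : ∀ j, w (e j) < μ)
    (hvμ : ∀ j, v (e j) < μ) (h1 : ∀ j, j < i → w j ≤ v j) (h2 : ∀ j, i < j → v j ≤ w j)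
    (hs : ∑ j, w (e j) = ∑ j, v (e j)) (hne : ∃ j, w (e j) ≠ v (e j)) :
    ∑ j, Real.log (1 - v (e j) / μ) < ∑ j, Real.log (1 - w (e j) / μ) := by
  -- The slope of -log(1 - x/μ) at the crossing value. Tangent slopes at w_j are larger before `i`
  -- and smaller after it, matching the sign of v_j - w_j, so all may be replaced by `c`; the linear
  -- terms then sum to zero.
  set c := (μ - w i)⁻¹
  have hlog : ∀ j, Real.log (1 - v (e j) / μ) - Real.log (1 - w (e j) / μ)
      = Real.log ((μ - v (e j)) / (μ - w (e j))) := fun j => by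
    have a := sub_pos.2 (hwμ j)
    have b := sub_pos.2 (hvμ j)
    rw [one_sub_div hμ.ne', one_sub_div hμ.ne', Real.log_div b.ne' hμ.ne',
      Real.log_div a.ne' hμ.ne', Real.log_div b.ne' a.ne']
    ring
  have hsub : ∀ j, (μ - v (e j)) / (μ - w (e j)) - 1 = (w (e j) - v (e j)) * (μ - w (e j))⁻¹ :=
    fun j => by
      have a := (sub_pos.2 (hwμ j)).ne'
      field_simp
      ring
  have hc : ∀ j, (w (e j) - v (e j)) * (μ - w (e j))⁻¹ ≤ (w (e j) - v (e j)) * c := fun j => by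
    have a := sub_pos.2 (hwμ j)
    have b := sub_pos.2 hwi
    rcases lt_trichotomy (e j) i with h | h | h
    · exact mul_le_mul_of_nonpos_left (inv_anti₀ a (by linarith [hw h.le])) (by linarith [h1 _ h])
    · rw [h]
    · exact mul_le_mul_of_nonneg_left (inv_anti₀ b (by linarith [hw h.le])) (by linarith [h2 _ h])
  have hpos : ∀ j, 0 < (μ - v (e j)) / (μ - w (e j)) := fun j =>
    div_pos (sub_pos.2 (hvμ j)) (sub_pos.2 (hwμ j))
  have hlt : ∑ j, (Real.log (1 - v (e j) / μ) - Real.log (1 - w (e j) / μ))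
      < ∑ j, (w (e j) - v (e j)) * c := by
    obtain ⟨k, hk⟩ := hne
    refine Finset.sum_lt_sum (fun j _ => ?_) ⟨k, Finset.mem_univ k, ?_⟩
    · rw [hlog]
      exact ((Real.log_le_sub_one_of_pos (hpos j)).trans_eq (hsub j)).trans (hc j)
    · rw [hlog]
      refine ((Real.log_lt_sub_one_of_pos (hpos k) fun h => hk ?_).trans_eq (hsub k)).trans_le (hc k)
      rw [div_eq_one_iff_eq (sub_pos.2 (hwμ k)).ne'] at h
      linarith
  rw [← Finset.sum_mul, Finset.sum_sub_distrib, Finset.sum_sub_distrib, hs, sub_self, zero_mul] at hlt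
  linarith

/-- If `v` majorizes `w ≠ v` with a single crossing and the same leading entry `μ`, the tail of the
weighted sum for `v` dominates eventually. -/
theorem eventually_tail_le_of_eq {n : ℕ} {w v : Fin n → ℝ} {i k : Fin n} {μ : ℝ} (hμ : 0 < μ)
    (hw : Antitone w) (hw0 : ∀ j, 0 ≤ w j)
    (hwμ : ∀ j, w j ≤ μ) (hvμ : ∀ j, v j ≤ μ) (hk : w k = μ)
    (h1 : ∀ j, j < i → w j ≤ v j) (h2 : ∀ j, i < j → v j ≤ w j)
    (hs : ∑ j, w j = ∑ j, v j) (hne : w ≠ v) :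
    ∀ᶠ t in atTop, (Measure.pi fun _ : Fin n => gaussianReal 0 1) {z | t < ∑ j, w j * z j ^ 2}
      ≤ (Measure.pi fun _ : Fin n => gaussianReal 0 1) {z | t < ∑ j, v j * z j ^ 2} := by
  -- An entry `μ` of `w` at or past the crossing would give v ≤ w everywhere, hence v = w. So `v`
  -- also equals `μ` wherever `w` does.
  have hlt_of : ∀ j, w j = μ → j < i := fun j hj => by
    by_contra! hij
    refine hne (eq_of_le_of_crossing hs (fun l hl => ?_) h2).symm
    exact (hvμ l).trans (hj.symm.le.trans (hw (hl.trans hij)))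
  have hveq : ∀ j, w j = μ → v j = μ := fun j hj =>
    le_antisymm (hvμ j) (hj.symm.le.trans (h1 j (hlt_of j hj)))
  have hwi : w i < μ := (hwμ i).lt_of_ne fun h => lt_irrefl _ (hlt_of i h)
  have hwlt : ∀ j : {j // ¬ w j = μ}, w j < μ := fun j => (hwμ j).lt_of_ne j.2
  have : Nonempty {j // w j = μ} := ⟨⟨k, hk⟩⟩
  have hg := isExpTail_chiSqTail {j // w j = μ} hμ
  set γ := 1 / (2 * μ) with hγdef
  have hγ : 0 < γ := by positivity
  -- Finitely many strict inequalities at `γ` survive a slight increase of the rate.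
  obtain ⟨s, hs1, hs2⟩ : ∃ s, (∀ j : {j // ¬ w j = μ}, s * w j < 1 / 2) ∧ γ < s := by
    have hev : ∀ᶠ s in 𝓝[>] γ, ∀ j : {j // ¬ w j = μ}, s * w j < 1 / 2 := by
      refine eventually_all.2 fun j => nhdsWithin_le_nhds ?_
      refine ((continuous_id.mul continuous_const).tendsto γ).eventually_lt_const ?_
      change γ * w j < 1 / 2
      rw [hγdef, one_div_mul_eq_div, div_lt_div_iff₀ (by positivity) two_pos]
      linarith [hwlt j]
    exact (hev.and self_mem_nhdsWithin).exists
  have hexp : ∀ (s : ℝ) (u : Fin n → ℝ), ∫⁻ y, ENNReal.ofReal (Real.exp (s *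
        ∑ j : {j // ¬ w j = μ}, u j * y j ^ 2))
        ∂(Measure.pi fun _ : {j // ¬ w j = μ} => gaussianReal 0 1)
      = ∫⁻ y, ENNReal.ofReal (Real.exp (∑ j : {j // ¬ w j = μ}, (s * u j) * y j ^ 2))
        ∂(Measure.pi fun _ : {j // ¬ w j = μ} => gaussianReal 0 1) := fun s u =>
    lintegral_congr fun y => by simp only [Finset.mul_sum, mul_assoc]
  have h2γ : ∀ x, 2 * (γ * x) = x / μ := fun x => by rw [hγdef]; field_simp
  have hmain := hg.eventually_lintegral_le hs2 (hγ.trans hs2).le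
    (ν := Measure.pi fun _ : {j // ¬ w j = μ} => gaussianReal 0 1)
    (B := fun y => ∑ j : {j // ¬ w j = μ}, w j * y j ^ 2)
    (B' := fun y => ∑ j : {j // ¬ w j = μ}, v j * y j ^ 2) (by fun_prop) (by fun_prop)
    (fun y => Finset.sum_nonneg fun j _ => mul_nonneg (hw0 j) (sq_nonneg _))
    (by rw [hexp, lintegral_exp_sum_sq_of_lt hs1]; exact ENNReal.ofReal_ne_top)
    (by
      rw [hexp, hexp, lintegral_exp_sum_sq_of_lt fun j : {j // ¬ w j = μ} =>
        (mul_le_mul_of_nonneg_right hs2.le (hw0 j)).trans_lt (hs1 j)]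
      -- If `v` has more entries `μ` than `w`, its moment is infinite; otherwise the strict Karamata
      -- inequality applies.
      by_cases hv : ∃ j : {j // ¬ w j = μ}, v j = μ
      · obtain ⟨j, hj⟩ := hv
        rw [lintegral_exp_sum_sq_of_ge (k := j)
          (by rw [hj, hγdef]; apply le_of_eq; field_simp)]
        exact ENNReal.ofReal_lt_top
      · push Not at hv
        have hvlt : ∀ j : {j // ¬ w j = μ}, v j < μ := fun j => (hvμ j).lt_of_ne (hv j)
        rw [lintegral_exp_sum_sq_of_lt fun j : {j // ¬ w j = μ} => by
          rw [hγdef, one_div_mul_eq_div, div_lt_div_iff₀ (by positivity) two_pos]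
          linarith [hvlt j]]
        refine (ENNReal.ofReal_lt_ofReal_iff (Real.exp_pos _)).2 (Real.exp_lt_exp.2 ?_)
        simp only [h2γ]
        have hI : ∑ j : {j // w j = μ}, w j = ∑ j : {j // w j = μ}, v j :=
          Finset.sum_congr rfl fun j _ => j.2.trans (hveq j j.2).symm
        have hs' : ∑ j : {j // ¬ w j = μ}, w j = ∑ j : {j // ¬ w j = μ}, v j := by
          rw [← Fintype.sum_subtype_add_sum_subtype (fun j => w j = μ) w,
            ← Fintype.sum_subtype_add_sum_subtype (fun j => w j = μ) v, hI] at hs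
          exact add_left_cancel hs
        obtain ⟨j, hj⟩ := Function.ne_iff.1 hne
        have := sum_log_lt_sum_log (Subtype.val : {j // ¬ w j = μ} → Fin n) hμ hw hwi hwlt hvlt
          h1 h2 hs' ⟨⟨j, fun h => hj (h.trans (hveq j h).symm)⟩, hj⟩
        linarith)
  filter_upwards [hmain] with t ht
  rw [pi_gaussianReal_tail_eq_lintegral (fun j => w j = μ) hμ (fun j h => h),
    pi_gaussianReal_tail_eq_lintegral (fun j => w j = μ) hμ hveq]
  simpa only [sub_div] using ht

/-- The crossing forces w_0 ≤ v_0: failure is possible only with the crossing at the first index,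
and then v ≤ w with equal sums. The leading entries decide which comparison applies. -/
theorem eventually_tail_le {n : ℕ} {w v : Fin n → ℝ} {i : Fin n} (hw : Antitone w)
    (hv : Antitone v) (hw0 : ∀ j, 0 ≤ w j) (hv0 : ∀ j, 0 ≤ v j)
    (h1 : ∀ j, j < i → w j ≤ v j) (h2 : ∀ j, i < j → v j ≤ w j)
    (hs : ∑ j, w j = ∑ j, v j) (hne : w ≠ v) :
    ∀ᶠ t in atTop, (Measure.pi fun _ : Fin n => gaussianReal 0 1) {z | t < ∑ j, w j * z j ^ 2}
      ≤ (Measure.pi fun _ : Fin n => gaussianReal 0 1) {z | t < ∑ j, v j * z j ^ 2} := by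
  let k : Fin n := ⟨0, i.pos⟩
  have hk : ∀ j, k ≤ j := fun j => Nat.zero_le _
  have hle : w k ≤ v k := by
    by_contra! h
    have hik : ¬ k < i := fun hki => absurd (h1 k hki) h.not_ge
    have hki : i = k := le_antisymm (not_lt.1 hik) (hk i)
    refine hne (eq_of_le_of_crossing hs (fun l hl => ?_) h2).symm
    rw [le_antisymm (hki ▸ hl) (hk l)]
    exact h.le
  rcases hle.lt_or_eq with h | h
  · exact eventually_tail_le_of_lt k hw0 hv0 (fun j => hw (hk j)) h
  · have hpos : 0 < v k := by
      refine (hv0 k).lt_of_ne fun h0 => hne ?_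
      funext j
      rw [le_antisymm ((hw (hk j)).trans (h.trans h0.symm).le) (hw0 j),
        le_antisymm ((hv (hk j)).trans h0.symm.le) (hv0 j)]
    exact eventually_tail_le_of_eq hpos hw hw0 (fun j => h ▸ hw (hk j)) (fun j => hv (hk j)) h h1 h2
      hs hne

/-! ### From tails to critical values -/

theorem weightedChiSq_real_Iic {n : ℕ} (w : Fin n → ℝ) (t : ℝ) :
    (weightedChiSq w).real (Set.Iic t)
      = 1 - (Measure.pi fun _ : Fin n => gaussianReal 0 1).real {z | t < ∑ j, w j * z j ^ 2} := by
  have hm : Measurable fun z : Fin n → ℝ => ∑ j, w j * z j ^ 2 := by fun_prop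
  rw [weightedChiSq, map_measureReal_apply hm measurableSet_Iic,
    ← probReal_compl_eq_one_sub (measurableSet_lt measurable_const hm)]
  congr 1
  ext z
  simp

/-- Every upper tail of a weighted sum with a positive weight is charged. -/
theorem pi_gaussianReal_real_tail_pos {n : ℕ} {v : Fin n → ℝ} (hv0 : ∀ j, 0 ≤ v j) {k : Fin n}
    (hk : 0 < v k) (t : ℝ) :
    0 < (Measure.pi fun _ : Fin n => gaussianReal 0 1).real {z | t < ∑ j, v j * z j ^ 2} := by
  rw [Measure.real, ENNReal.toReal_pos_iff]
  refine ⟨?_, measure_lt_top _ _⟩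
  have : Nonempty {j // v j = v k} := ⟨⟨k, rfl⟩⟩
  have hg := isExpTail_chiSqTail {j // v j = v k} hk
  exact (ENNReal.ofReal_pos.2 (hg.pos t)).trans_le (ofReal_chiSqTail_le_tail hv0 hk t)

/-- Once α is below the tail of `v` at the threshold T, every t admissible for `v` lies beyond T,
where the tail of `w` is no larger; so t is admissible for `w` as well. -/
theorem eventually_critValue_le {n : ℕ} {w v : Fin n → ℝ} (hw0 : ∀ j, 0 ≤ w j)
    (hv0 : ∀ j, 0 ≤ v j) {k : Fin n} (hk : 0 < v k)
    (h : ∀ᶠ t in atTop,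
      (Measure.pi fun _ : Fin n => gaussianReal 0 1) {z | t < ∑ j, w j * z j ^ 2}
        ≤ (Measure.pi fun _ : Fin n => gaussianReal 0 1) {z | t < ∑ j, v j * z j ^ 2}) :
    ∀ᶠ α in 𝓝[>] (0 : ℝ), critValue α w ≤ critValue α v := by
  obtain ⟨T, hT⟩ := eventually_atTop.1 h
  set P := Measure.pi fun _ : Fin n => gaussianReal 0 1
  have hpos := pi_gaussianReal_real_tail_pos hv0 hk T
  have hsmall : ∀ᶠ α in 𝓝[>] (0 : ℝ), α < min 1 (P.real {z | T < ∑ j, v j * z j ^ 2}) :=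
    nhdsWithin_le_nhds (eventually_lt_nhds (lt_min one_pos hpos))
  filter_upwards [hsmall, self_mem_nhdsWithin] with α hα hα0
  have hα1 := hα.trans_le (min_le_left _ _)
  have hα2 := hα.trans_le (min_le_right _ _)
  -- Boundedness and nonemptiness exclude the default value 0 of `sInf`; α < 1 makes negative t
  -- inadmissible for `w`.
  refine csInf_le_csInf ⟨0, fun t ht => ?_⟩ ?_ fun t ht => ?_
  · by_contra! h0
    rw [Set.mem_ofPred_eq, weightedChiSq_real_Iic] at ht
    have huniv : {z : Fin n → ℝ | t < ∑ j, w j * z j ^ 2} = Set.univ :=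
      Set.eq_univ_of_forall fun z =>
        h0.trans_le (Finset.sum_nonneg fun j _ => mul_nonneg (hw0 j) (sq_nonneg _))
    rw [huniv, probReal_univ] at ht
    linarith
  · have hm : Measurable fun z : Fin n → ℝ => ∑ j, v j * z j ^ 2 := by fun_prop
    have : IsProbabilityMeasure (weightedChiSq v) := Measure.isProbabilityMeasure_map hm.aemeasurable
    have hlim : Tendsto (fun t => (weightedChiSq v).real (Set.Iic t)) atTop (𝓝 1) := by
      have := tendsto_measure_Iic_atTop (weightedChiSq v)
      rw [measure_univ] at this
      exact (ENNReal.tendsto_toReal ENNReal.one_ne_top).comp this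
    obtain ⟨t, ht⟩ := (hlim.eventually_const_lt (show 1 - α < 1 by
      have : 0 < α := hα0
      linarith)).exists
    exact ⟨t, ht.le⟩
  · rw [Set.mem_ofPred_eq, weightedChiSq_real_Iic] at ht ⊢
    have htT : T ≤ t := by
      by_contra! hlt
      have : P.real {z | T < ∑ j, v j * z j ^ 2} ≤ P.real {z | t < ∑ j, v j * z j ^ 2} :=
        measureReal_mono fun z hz => hlt.trans hz
      linarith
    have : P.real {z | t < ∑ j, w j * z j ^ 2} ≤ P.real {z | t < ∑ j, v j * z j ^ 2} :=
      ENNReal.toReal_mono (measure_ne_top _ _) (hT t htT)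
    linarith

/-! ### Critical values of the majorizing vector -/

theorem IsMajorizingVector.le {n : ℕ} {up lo v : Fin n → ℝ} {ℓ : ℝ}
    (h : IsMajorizingVector up lo ℓ v) (hle : lo ≤ up) : lo ≤ v := by
  obtain ⟨i, η, v1, v2, v3, v4, -⟩ := h
  intro j
  rcases lt_trichotomy j i with hj | rfl | hj
  · exact (hle j).trans (v1 j hj).ge
  · exact v4.trans v2.ge
  · exact (v3 j hj).ge

theorem IsMajorizingVector.eventually_critValue_le {n : ℕ} {up lo v w : Fin n → ℝ} {ℓ : ℝ}
    (hv : IsMajorizingVector up lo ℓ v) (hlo : lo ≤ w) (hup : w ≤ up) (h0 : ∀ j, 0 ≤ lo j)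
    (hw : Antitone w) (hs : ∑ j, w j = ℓ) :
    ∀ᶠ α in 𝓝[>] (0 : ℝ), critValue α w ≤ critValue α v := by
  by_cases hne : w = v
  · exact Eventually.of_forall fun α => by rw [hne]
  have hw0 : ∀ j, 0 ≤ w j := fun j => (h0 j).trans (hlo j)
  have hv0 : ∀ j, 0 ≤ v j := fun j => (h0 j).trans (hv.le (hlo.trans hup) j)
  have hsum : ∑ j, w j = ∑ j, v j := hs.trans hv.sum_eq.symm
  obtain ⟨k, hk⟩ : ∃ k, 0 < v k := by
    by_contra! hall
    refine hne (eq_of_le_of_sum_eq (fun j => ?_) hsum.symm).symm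
    exact (hall j).trans (hw0 j)
  obtain ⟨i, h1, h2⟩ := hv.exists_crossing hlo hup
  exact _root_.eventually_critValue_le hw0 hv0 hk
    (eventually_tail_le hw hv.antitone hw0 hv0 h1 h2 hsum hne)

theorem lemma3 {n p m : ℕ} (hp : p < n)
    (Z : Matrix (Fin n) (Fin p) ℝ) (hZ : IsUnit (Z.transpose * Z).det)
    (X : Matrix (Fin n) (Fin m) ℝ)
    (σ : Fin n → ℝ) (hσ : ∀ i, 0 ≤ σ i)
    (R : Finset (Fin m)) :
    (∀ S : Finset (Fin m), R ⊆ S → S ⊆ Finset.univ →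
      ∃! v : Fin n → ℝ,
        IsMajorizingVector (nullWeights Z X σ Finset.univ) (nullWeights Z X σ R)
          (level Z X σ S) v) ∧
    ∃ α₀ : ℝ, 0 < α₀ ∧ α₀ < 1 ∧
      ∀ α : ℝ, 0 < α → α ≤ α₀ →
        ∀ S : Finset (Fin m), R ⊆ S → S ⊆ Finset.univ →
          ∀ v : Fin n → ℝ,
            IsMajorizingVector (nullWeights Z X σ Finset.univ) (nullWeights Z X σ R)
              (level Z X σ S) v →
            critValue α (nullWeights Z X σ S) ≤ critValue α v := by
  have hle : nullWeights Z X σ R ≤ nullWeights Z X σ Finset.univ :=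
    nullWeights_mono Z X σ (Finset.subset_univ R)
  have hanti : ∀ S, Antitone (nullWeights Z X σ S) := fun S => sortedEigenvalues_antitone _
  have hex : ∀ S : Finset (Fin m), R ⊆ S → S ⊆ Finset.univ →
      ∃! v : Fin n → ℝ,
        IsMajorizingVector (nullWeights Z X σ Finset.univ) (nullWeights Z X σ R)
          (level Z X σ S) v := fun S hRS hS => by
    obtain ⟨v, hv⟩ := exists_isMajorizingVector (Nat.zero_lt_of_lt hp) (hanti Finset.univ) (hanti R)
      hle (ℓ := level Z X σ S) (Finset.sum_le_sum fun j _ => nullWeights_mono Z X σ hRS j)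
      (Finset.sum_le_sum fun j _ => nullWeights_mono Z X σ hS j)
    exact ⟨v, hv, fun v' hv' => hv'.unique hle hv⟩
  refine ⟨hex, ?_⟩
  have hev : ∀ᶠ α in 𝓝[>] (0 : ℝ), ∀ S : Finset (Fin m), R ⊆ S → S ⊆ Finset.univ →
      ∀ v : Fin n → ℝ,
        IsMajorizingVector (nullWeights Z X σ Finset.univ) (nullWeights Z X σ R)
          (level Z X σ S) v →
        critValue α (nullWeights Z X σ S) ≤ critValue α v := by
    -- Finiteness of the collection of sets `S` makes the threshold for α uniform.
    refine eventually_all.2 fun S => ?_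
    by_cases hRS : R ⊆ S
    · obtain ⟨v, hv, huniq⟩ := hex S hRS (Finset.subset_univ S)
      filter_upwards [hv.eventually_critValue_le (nullWeights_mono Z X σ hRS)
        (nullWeights_mono Z X σ (Finset.subset_univ S)) (nullWeights_nonneg Z X σ R) (hanti S) rfl]
        with α hα _ _ v' hv'
      rwa [huniq v' hv']
    · exact Eventually.of_forall fun α h => absurd h hRS
  obtain ⟨u, hu, hsub⟩ := mem_nhdsGT_iff_exists_Ioc_subset.1 hev
  exact ⟨min u (1 / 2), lt_min hu (by norm_num), (min_le_right _ _).trans_lt (by norm_num),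
    fun α h0 h1 => hsub ⟨h0, h1.trans (min_le_left _ _)⟩⟩
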